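/- Call a graph $G$ on $n$ vertices $\delta$-dense ($0<\delta<1$) if its minimum degree is at least $\delta n$. Consider the following randomized algorithm for laying out $G$ with small bandwidth, run on a unit-cost random access machine; the input is $n$, the adjacency matrix of $G$, a number $r\le n$ and $\lceil\delta n\rceil$. 1. Select a random set $R'$ of $r$ vertices (the roots). 2. Run a breadth first search from every vertex of $R'$. 3. Create a table with a row for each vertex $v$ and a column for each root $u$, recording whether $d(u,v)=0$, $1\le d(u,v)\le 2$ or $d(u,v)>2$. 4. Search, by binary search over the integers $s$ with $\delta n\le s\le n/2$, for a box size $s$ that admits a layout. To test $s$, go through the placements $B:R'\to\{1,\dots,b\}$ of the roots into $b=\lceil n/s\rceil$ boxes until one succeeds. For each placement, update the table and the intervals $I_v=\bigcap_{u\in R',\,d(u,v)\le 2}\{B(u)-2,\dots,B(u)+2\}\cap\{1,\dots,b\}$ (for $v\in R'$ additionally intersected with $\{B(v)\}$); for all $i\le j$ count $c_{ij}=|\{v: I_v=\{i,\dots,j\}\}|$; create the flow network with arcs from a source to the node $B_{ij}$ of capacity $c_{ij}$, from $B_{ij}$ to each of the boxes $i,\dots,j$ of infinite capacity, and from each box to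 a sink of capacity $s$; compute a maximum flow (by the Edmonds–Karp algorithm); if its value is $n$, convert the flow into a layout, and the test of $s$ succeeds. **Lemma 7.** Let $A>0$ be a constant. There is a constant $K>0$ depending only on $A$ such that for every $0<\delta<1$ there is a constant $C>0$ depending only on $A$ and $\delta$ with the following property. For all $n\ge 3$, every $\delta$-dense graph $G$ on $n$ vertices, every $r\le \min\{n,\ A\cdot\frac1\delta\log\log n\}$ and every outcome of the random choices: * the algorithm runs in time at most $C\,n^2\log\log n$; * the breadth first searches (step 2) take time at most $C\,n^2\log\log n$; * the creation of the table (step 3) takes time at most $C\,n\log\log n$; * for every box size $s$ with $\delta n\le s\le n/2$, the number of placements of the roots satisfies $\lceil n/s\rceil^{\,r}\le(\log n)^{K\frac1\delta\log\frac1\delta}$; * step 4 as a whole takes time at most $C\,n\log\log n\cdot(\log n)^{K\frac1\delta\log\frac1\delta}$. Moreover, for fixed $A$ and $\delta$, the time of step 4 is $o(n^2\log\log n)$, uniformly in $G$, $r$ and the random choices. -/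

import Mathlib

namespace Bandwidth

/-! ## Dense graphs -/

/-- `G` is `δ`-dense: its minimum degree is at least `δ n`, where `n` is the number of vertices. -/
def IsDense {n : ℕ} (δ : ℝ) (G : SimpleGraph (Fin n)) [DecidableRel G.Adj] : Prop :=
  δ * (n : ℝ) ≤ (G.minDegree : ℝ)

/-! ## The machine model

A random access machine with unit costs. It has finitely many named registers and finitely many
named tables (two-dimensional arrays), all holding natural numbers; it can draw random numbers.
Programs are structured: assignments, table writes, conditionals and counted loops with an exit
condition. Every arithmetic operation, comparison, register access, table access, constant, random
draw, branch and loop iteration costs one step. -/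

/-- Names of the registers. -/
inductive Reg where
  /-- input: number of vertices -/
  | n
  /-- input: number of roots -/
  | r
  /-- input: smallest box size to be considered -/
  | smin
  /-- current box size -/
  | s
  /-- current number of boxes -/
  | b
  /-- left end of the range of box sizes still to be searched -/
  | lo
  /-- right end of the range of box sizes still to be searched -/
  | hi
  /-- set to `1` once a layout has been found -/
  | success
  /-- set to `1` once a layout has been found for the current box size -/
  | found
  /-- number of placements of the roots -/
  | total
  /-- index of the current placement -/
  | p
  /-- left end of an interval of boxes -/
  | left
  /-- right end of an interval of boxes -/
  | right
  /-- a count of vertices -/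
  | cnt
  /-- number of nodes of the flow network -/
  | nodes
  /-- source of the flow network -/
  | src
  /-- sink of the flow network -/
  | snk
  /-- value of the current flow -/
  | flow
  /-- bottleneck capacity of an augmenting path -/
  | delta
  /-- loop flag -/
  | going
  /-- next free label -/
  | next
  | head | tail | u | v | w | i | j | k | x | y | q | round | phase
  deriving DecidableEq

/-- Names of the tables. -/
inductive Arr where
  /-- input: adjacency matrix -/
  | adj
  /-- output: the label of a vertex, in `1, …, n` -/
  | label
  /-- output: the box of a vertex -/
  | box
  /-- a permutation of the vertices -/
  | perm
  /-- the roots -/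
  | root
  /-- row: vertex, column: root; their distance -/
  | dist
  /-- row: vertex, column: root; how many boxes they can be apart -/
  | rad
  /-- row: vertex, column: root; first box allowed by the root -/
  | first
  /-- row: vertex, column: root; last box allowed by the root -/
  | last
  /-- first box of the interval `I_v` -/
  | ivFirst
  /-- last box of the interval `I_v` -/
  | ivLast
  /-- the box in which a root is placed -/
  | place
  /-- residual capacities of the flow network -/
  | cap
  /-- predecessors in a search of the flow network -/
  | pred
  /-- queue of a breadth first search -/
  | queue
  deriving DecidableEq

/-- Operations of the machine. Comparisons return `1` for true and `0` for false; subtraction is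
truncated at `0`; division rounds down. -/
inductive Op where
  | add | sub | mul | div | mod | min | max | le | lt | eq | ne

/-- The value of an operation. -/
def Op.eval : Op → ℕ → ℕ → ℕ
  | .add, a, b => a + b
  | .sub, a, b => a - b
  | .mul, a, b => a * b
  | .div, a, b => a / b
  | .mod, a, b => a % b
  | .min, a, b => Nat.min a b
  | .max, a, b => Nat.max a b
  | .le, a, b => if a ≤ b then 1 else 0
  | .lt, a, b => if a < b then 1 else 0
  | .eq, a, b => if a = b then 1 else 0
  | .ne, a, b => if a = b then 0 else 1

/-- Expressions: constants, registers, table entries, operations. -/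
inductive Expr where
  | lit (c : ℕ)
  | reg (x : Reg)
  | get (a : Arr) (i j : Expr)
  | op (o : Op) (e f : Expr)

instance : Coe Reg Expr := ⟨Expr.reg⟩
instance (c : ℕ) : OfNat Expr c := ⟨Expr.lit c⟩
instance : Add Expr := ⟨Expr.op .add⟩
instance : Sub Expr := ⟨Expr.op .sub⟩
instance : Mul Expr := ⟨Expr.op .mul⟩
instance : Div Expr := ⟨Expr.op .div⟩
instance : Mod Expr := ⟨Expr.op .mod⟩

/-- Programs. -/
inductive Cmd where
  /-- do nothing -/
  | skip
  /-- `x := e` -/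
  | set (x : Reg) (e : Expr)
  /-- `a[i, j] := e` -/
  | put (a : Arr) (i j e : Expr)
  /-- `x :=` a uniformly random element of `{0, …, e}` -/
  | draw (x : Reg) (e : Expr)
  /-- first `c`, then `d` -/
  | seq (c d : Cmd)
  /-- if `g ≠ 0` then `c` else `d` -/
  | ite (g : Expr) (c d : Cmd)
  /-- for `x` from `0` to `e - 1` do `c`, leaving the loop as soon as `g = 0` holds
  at the beginning of an iteration; the number `e` is evaluated once, on entry -/
  | loop (x : Reg) (e g : Expr) (c : Cmd)

infixr:60 " ;; " => Cmd.seq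

/-- if `g ≠ 0` then `c` -/
abbrev Cmd.when (g : Expr) (c : Cmd) : Cmd := .ite g c .skip

/-- for `x` from `0` to `e - 1` do `c` -/
abbrev Cmd.for (x : Reg) (e : Expr) (c : Cmd) : Cmd := .loop x e 1 c

/-- States of the machine: contents of the registers, contents of the tables, and the number of
random draws made so far. -/
structure State where
  reg : Reg → ℕ
  arr : Arr → ℕ → ℕ → ℕ
  drawn : ℕ

/-- Overwrite a register. -/
def State.setReg (σ : State) (x : Reg) (a : ℕ) : State :=
  { σ with reg := fun y => if y = x then a else σ.reg y }

/-- Overwrite a table entry. -/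
def State.setArr (σ : State) (t : Arr) (i j a : ℕ) : State :=
  { σ with arr := fun t' i' j' => if t' = t ∧ i' = i ∧ j' = j then a else σ.arr t' i' j' }

/-- A source of randomness: `ω m e` is the outcome of the `m`-th draw if that draw is one from
`{0, …, e}`. -/
abbrev Draws : Type := (m e : ℕ) → Fin (e + 1)

/-- The value of an expression. -/
def Expr.eval (σ : State) : Expr → ℕ
  | .lit c => c
  | .reg x => σ.reg x
  | .get a i j => σ.arr a (i.eval σ) (j.eval σ)
  | .op o e f => o.eval (e.eval σ) (f.eval σ)

/-- The number of steps needed to evaluate an expression. -/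
def Expr.cost : Expr → ℕ
  | .lit _ => 1
  | .reg _ => 1
  | .get _ i j => i.cost + j.cost + 1
  | .op _ e f => e.cost + f.cost + 1

/-- Iteration of a loop body: `m` iterations are left, the next one has index `i`. -/
def runLoop (x : Reg) (g : Expr) (body : State → State × ℕ) : ℕ → ℕ → State → State × ℕ
  | 0, _, σ => (σ, 1)
  | m + 1, i, σ =>
    let σ₀ := σ.setReg x i
    if g.eval σ₀ = 0 then (σ₀, g.cost + 2)
    else
      let ρ₁ := body σ₀
      let ρ₂ := runLoop x g body m (i + 1) ρ₁.1
      (ρ₂.1, g.cost + 2 + ρ₁.2 + ρ₂.2)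

/-- Execution of a program: the final state and the number of steps. -/
def run (ω : Draws) : Cmd → State → State × ℕ
  | .skip, σ => (σ, 1)
  | .set x e, σ => (σ.setReg x (e.eval σ), e.cost + 1)
  | .put a i j e, σ =>
    (σ.setArr a (i.eval σ) (j.eval σ) (e.eval σ), i.cost + j.cost + e.cost + 1)
  | .draw x e, σ =>
    ({ σ.setReg x (ω σ.drawn (e.eval σ)).val with drawn := σ.drawn + 1 }, e.cost + 1)
  | .seq c d, σ =>
    let ρ₁ := run ω c σ
    let ρ₂ := run ω d ρ₁.1
    (ρ₂.1, ρ₁.2 + ρ₂.2)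
  | .ite g c d, σ =>
    let ρ := if g.eval σ = 0 then run ω d σ else run ω c σ
    (ρ.1, g.cost + 1 + ρ.2)
  | .loop x e g c, σ =>
    let ρ := runLoop x g (run ω c) (e.eval σ) 0 σ
    (ρ.1, e.cost + ρ.2)

/-- The final state of a program. -/
def exec (ω : Draws) (c : Cmd) (σ : State) : State := (run ω c σ).1

/-- The number of steps of a program. -/
def time (ω : Draws) (c : Cmd) (σ : State) : ℕ := (run ω c σ).2

/-! ## The algorithm

Vertices, boxes and roots are numbered from `0`. One-dimensional tables use column `0` only. -/

section Program

open Reg Arr Cmd Expr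

/-- Select a random set of `r` vertices, the roots: the first `r` entries of a random permutation
(Fisher--Yates shuffle, stopped after `r` rounds). -/
def selectRoots : Cmd :=
  .for v n (put perm v 0 v) ;;
  .for k r (
    draw x (n - 1 - k) ;;
    set x (k + x) ;;
    set y (get perm k 0) ;;
    put perm k 0 (get perm x 0) ;;
    put perm x 0 y ;;
    put root k 0 (get perm k 0))

/-- Breadth first search from every root; `n + 2` marks the vertices not reached. -/
def bfsFromRoots : Cmd :=
  .for k r (
    set u (get root k 0) ;;
    .for v n (put dist v k (n + 2)) ;;
    put dist u k 0 ;;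
    put queue 0 0 u ;;
    set tail 1 ;;
    loop head n (op .lt head tail) (
      set v (get queue head 0) ;;
      .for w n (
        .when (get adj v w) (
          .when (op .eq (get dist w k) (n + 2)) (
            put dist w k (get dist v k + 1) ;;
            put queue tail 0 w ;;
            set tail (tail + 1))))))

/-- Create the table with a row for every vertex `v` and a column for every root `u`. It records how
many boxes `v` can be away from `u`: none if `v = u`, two if `1 ≤ d(u, v) ≤ 2`, and any number
(`n` boxes) if `u` does not dominate `v` within two hops. -/
def createTable : Cmd :=
  .for v n (
    .for k r (
      .ite (op .eq (get dist v k) 0) (put rad v k 0) (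
        .ite (op .le (get dist v k) 2) (put rad v k 2) (
          put rad v k n))))

/-- The `p`-th placement of the roots into the `b` boxes: the digits of `p` in base `b`. -/
def placeRoots : Cmd :=
  set q p ;;
  .for k r (
    put place k 0 (op .mod q b) ;;
    set q (q / b))

/-- Update the table: for every vertex `v` and every root `u` the first and the last box that `u`
allows for `v`, and the interval `I_v`, the intersection of these over all roots. -/
def updateIntervals : Cmd :=
  .for v n (
    set left 0 ;;
    set right (b - 1) ;;
    .for k r (
      put first v k (get place k 0 - get rad v k) ;;
      put last v k (op .min (b - 1) (get place k 0 + get rad v k)) ;;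
      set left (op .max left (get first v k)) ;;
      set right (op .min right (get last v k))) ;;
    put ivFirst v 0 left ;;
    put ivLast v 0 right)

/-- Create the flow network. The interval `{i, …, j}` of boxes is node `i * b + j`, the box `k` is
node `b * b + k`, followed by the source and the sink. The source is joined to the interval
`{i, …, j}` with capacity `c_{ij}`, the number of vertices `v` with `I_v = {i, …, j}`; every interval
to each of its boxes with infinite capacity (represented by `n`, which no flow can exceed because the
capacities at the source sum up to at most `n`); every box to the sink with the box size as
capacity. -/
def createNetwork : Cmd :=
  set src (b * b + b) ;;
  set snk (src + 1) ;;
  set nodes (src + 2) ;;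
  .for x nodes (.for y nodes (put cap x y 0)) ;;
  .for i b (
    .for j b (
      .when (op .le i j) (
        set cnt 0 ;;
        .for v n (
          .when (op .eq (get ivFirst v 0) i) (
            .when (op .eq (get ivLast v 0) j) (
              set cnt (cnt + 1)))) ;;
        put cap src (i * b + j) cnt ;;
        .for k b (
          .when (op .le i k) (
            .when (op .le k j) (
              put cap (i * b + j) (b * b + k) n)))))) ;;
  .for k b (put cap (b * b + k) snk s)

/-- Breadth first search for an augmenting path in the residual network; the value `nodes` in `pred`
marks the nodes not reached. -/
def findPath : Cmd :=
  .for x nodes (put pred x 0 nodes) ;;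
  put pred src 0 src ;;
  put queue 0 0 src ;;
  set tail 1 ;;
  loop head nodes (op .lt head tail) (
    set x (get queue head 0) ;;
    .for y nodes (
      .when (get cap x y) (
        .when (op .eq (get pred y 0) nodes) (
          put pred y 0 x ;;
          put queue tail 0 y ;;
          set tail (tail + 1)))))

/-- Augment the flow along the path that was found, by its bottleneck capacity. -/
def augment : Cmd :=
  set delta n ;;
  set y snk ;;
  loop q nodes (op .ne y src) (
    set x (get pred y 0) ;;
    set delta (op .min delta (get cap x y)) ;;
    set y x) ;;
  set y snk ;;
  loop q nodes (op .ne y src) (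
    set x (get pred y 0) ;;
    put cap x y (get cap x y - delta) ;;
    put cap y x (get cap y x + delta) ;;
    set y x) ;;
  set flow (flow + delta)

/-- Maximum flow by the algorithm of Edmonds and Karp: augment along shortest paths of the residual
network until there are none. The number of augmentations of this algorithm is less than the
number of nodes times the number of arcs, so the bound on the number of rounds is never reached. -/
def maxFlow : Cmd :=
  set flow 0 ;;
  set going 1 ;;
  loop round (nodes * nodes * nodes) going (
    findPath ;;
    .ite (op .eq (get pred snk 0) nodes) (set going 0) augment)

/-- Convert a flow of value `n` to a layout. The flow from the interval `{i, …, j}` to the box `k` is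
the residual capacity of the reversed arc; that many vertices `v` with `I_v = {i, …, j}` are put into
box `k`. Then the vertices are labelled `1, …, n`, box by box. -/
def convert : Cmd :=
  .for v n (
    set x (get ivFirst v 0 * b + get ivLast v 0) ;;
    set going 1 ;;
    loop k b going (
      .when (get cap (b * b + k) x) (
        put cap (b * b + k) x (get cap (b * b + k) x - 1) ;;
        put box v 0 k ;;
        set going 0))) ;;
  set next 1 ;;
  .for k b (
    .for v n (
      .when (op .eq (get box v 0) k) (
        put label v 0 next ;;
        set next (next + 1))))

/-- Test the box size `s`, with `b = ⌈n / s⌉` boxes: for each of the `b ^ r` placements of the roots,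
until a layout is found, update the intervals, create and solve the flow instance, and convert the
solution to a layout if the value of the flow is `n`. -/
def testBoxSize : Cmd :=
  set b ((n + s - 1) / s) ;;
  set total 1 ;;
  .for k r (set total (total * b)) ;;
  set found 0 ;;
  loop p total (op .eq found 0) (
    placeRoots ;;
    updateIntervals ;;
    createNetwork ;;
    maxFlow ;;
    .when (op .eq flow n) (
      convert ;;
      set found 1))

/-- Binary search over the box sizes from `smin` to `n / 2`. Every iteration removes a box size from
the range, so the bound `n` on the number of iterations is never reached. -/
def searchLayout : Cmd :=
  set lo smin ;;
  set hi (n / 2) ;;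
  set success 0 ;;
  loop phase n (op .le lo hi) (
    set s ((lo + hi) / 2) ;;
    testBoxSize ;;
    .ite found (set hi (s - 1) ;; set success 1) (set lo (s + 1)))

/-- The whole algorithm. -/
def algorithm2 : Cmd :=
  selectRoots ;; bfsFromRoots ;; createTable ;; searchLayout

end Program

/-- The initial state for the graph `G`: the registers `n`, `r` and `smin` hold the number of
vertices, the number `r` of roots to be selected and `⌈δ n⌉`; the table `adj` is the adjacency matrix of `G`;
everything else is `0`. -/
noncomputable def input {n : ℕ} (δ : ℝ) (G : SimpleGraph (Fin n)) [DecidableRel G.Adj] (r : ℕ) :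
    State where
  reg := fun x =>
    match x with
    | .n => n
    | .r => r
    | .smin => ⌈δ * (n : ℝ)⌉₊
    | _ => 0
  arr := fun t i j =>
    match t with
    | .adj => if h : i < n ∧ j < n then (if G.Adj ⟨i, h.1⟩ ⟨j, h.2⟩ then 1 else 0) else 0
    | _ => 0
  drawn := 0

/-- The state when the breadth first searches begin, that is, after the selection of the roots. -/
noncomputable def stateBfs {n : ℕ} (ω : Draws) (δ : ℝ) (G : SimpleGraph (Fin n))
    [DecidableRel G.Adj] (r : ℕ) : State :=
  exec ω selectRoots (input δ G r)

/-- The state when the creation of the table begins. -/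
noncomputable def stateTable {n : ℕ} (ω : Draws) (δ : ℝ) (G : SimpleGraph (Fin n))
    [DecidableRel G.Adj] (r : ℕ) : State :=
  exec ω bfsFromRoots (stateBfs ω δ G r)

/-- The state when the search for a layout begins. -/
noncomputable def stateSearch {n : ℕ} (ω : Draws) (δ : ℝ) (G : SimpleGraph (Fin n))
    [DecidableRel G.Adj] (r : ℕ) : State :=
  exec ω createTable (stateTable ω δ G r)

end Bandwidth

namespace Bandwidth

/-! ### A static bound on the running time -/

/-! Outside the binary search, nothing about the behaviour of the algorithm matters: a loop costs at
most its bound, evaluated on entry, times the worst cost of its body, exit conditions ignored. If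
the bounds are sums and products of registers that the program does not write, the cost is at most a
polynomial with natural coefficients in those registers (`time_le_costBound`), and its degrees are
read off the syntax (`costBound_caps_le`). This gives `O(n (r + 1))` for the selection of the roots
and the table, and `O(n² (r + 1))` for the breadth first searches; here `r + 1 = O(log log n)`.

Testing a box size recomputes `b`, `total` and `nodes`, which are loop bounds themselves, so the
static bound is applied between these assignments. Since `s ≥ δ n`, there are at most `B = ⌈1/δ⌉`
boxes. The flow network thus has size bounded in terms of `δ`, each placement costs `O(n (r + 1))`,
and there are at most `B ^ r` placements (`time_testBoxSize_le`). The binary search halves its range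
in every round, so there are `O(log n)` tests (`time_searchLoop_le`).

For `δ ≤ 1/2` one has `B ≤ (1/δ)²`, hence `B ^ r ≤ exp (2 r log (1/δ))`, a power of `log n` with
exponent `2A (1/δ) log (1/δ)`. The factor `log n` of the binary search fits into the exponent
because `(1/δ) log (1/δ) ≥ 1`. For `δ > 1/2` no box size lies between `δ n` and `n / 2`, and the
search stops at once. Powers of `log n` are `o(n)`, so the search is negligible against `n² log log
n`. -/

/-- The expression is built from constants and registers in `S` by sums and products. -/
def Expr.monoIn (S : Reg → Bool) : Expr → Bool
  | .lit _ => true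
  | .reg x => S x
  | .get _ _ _ => false
  | .op .add e f => e.monoIn S && f.monoIn S
  | .op .mul e f => e.monoIn S && f.monoIn S
  | .op _ _ _ => false

/-- The value of a sum of products when the registers have the values `τ`. -/
def Expr.bound (τ : Reg → ℕ) : Expr → ℕ
  | .lit c => c
  | .reg x => τ x
  | .get _ _ _ => 0
  | .op .add e f => e.bound τ + f.bound τ
  | .op .mul e f => e.bound τ * f.bound τ
  | .op _ _ _ => 0

/-- The program does not write the registers in `S`. -/
def Cmd.keeps (S : Reg → Bool) : Cmd → Bool
  | .skip => true
  | .set x _ => !S x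
  | .put _ _ _ _ => true
  | .draw x _ => !S x
  | .seq c d => c.keeps S && d.keeps S
  | .ite _ c d => c.keeps S && d.keeps S
  | .loop x _ _ c => !S x && c.keeps S

/-- All loop bounds of the program are monotone in registers of `S`. -/
def Cmd.boundedBy (S : Reg → Bool) : Cmd → Bool
  | .seq c d => c.boundedBy S && d.boundedBy S
  | .ite _ c d => c.boundedBy S && d.boundedBy S
  | .loop _ e _ c => e.monoIn S && c.boundedBy S
  | _ => true

/-- A bound on the running time when the loop bounds are evaluated with the registers `τ`. -/
def Cmd.costBound (τ : Reg → ℕ) : Cmd → ℕ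
  | .skip => 1
  | .set _ e => e.cost + 1
  | .put _ i j e => i.cost + j.cost + e.cost + 1
  | .draw _ e => e.cost + 1
  | .seq c d => c.costBound τ + d.costBound τ
  | .ite g c d => g.cost + 1 + (c.costBound τ + d.costBound τ)
  | .loop _ e g c => e.cost + (1 + e.bound τ * (g.cost + 2 + c.costBound τ))

/-- Sums and products of naturals are monotone; truncated subtraction, division and table entries
are excluded because they would break this. -/
theorem Expr.eval_le_bound {S : Reg → Bool} {τ : Reg → ℕ} {σ : State}
    (h : ∀ x, S x = true → σ.reg x ≤ τ x) :
    ∀ e : Expr, e.monoIn S = true → e.eval σ ≤ e.bound τ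
  | .lit _, _ => le_rfl
  | .reg x, he => h x he
  | .get _ _ _, he => by simp [Expr.monoIn] at he
  | .op o e f, he => by
    cases o <;> simp only [Expr.monoIn, Bool.and_eq_true, Bool.false_eq_true] at he
    · exact Nat.add_le_add (eval_le_bound h e he.1) (eval_le_bound h f he.2)
    · exact Nat.mul_le_mul (eval_le_bound h e he.1) (eval_le_bound h f he.2)

theorem setReg_reg_of_ne {σ : State} {x y : Reg} {a : ℕ} (h : y ≠ x) :
    (σ.setReg x a).reg y = σ.reg y := by simp [State.setReg, h]

/-- An invariant and a time bound of the body of a loop give the same for the loop. -/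
theorem runLoop_spec {x : Reg} {g : Expr} {body : State → State × ℕ} {P : State → Prop} {T : ℕ}
    (hx : ∀ σ a, P σ → P (σ.setReg x a))
    (hb : ∀ σ, P σ → P (body σ).1 ∧ (body σ).2 ≤ T) :
    ∀ (m i : ℕ) (σ : State), P σ →
      P (runLoop x g body m i σ).1 ∧
        (runLoop x g body m i σ).2 ≤ 1 + m * (g.cost + 2 + T)
  | 0, _, σ, h => by simpa [runLoop] using h
  | m + 1, i, σ, h => by
    have h0 := hx σ i h
    by_cases hg : g.eval (σ.setReg x i) = 0
    · simp only [runLoop, hg, if_true]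
      refine ⟨h0, ?_⟩
      rw [Nat.add_mul, Nat.one_mul]
      omega
    · have h1 := hb _ h0
      have h2 := runLoop_spec (g := g) hx hb m (i + 1) _ h1.1
      simp only [runLoop, hg, if_false]
      refine ⟨h2.1, ?_⟩
      rw [Nat.add_mul, Nat.one_mul]
      have := h1.2
      have := h2.2
      omega

theorem run_reg_of_keeps {S : Reg → Bool} (ω : Draws) :
    ∀ (c : Cmd) (σ : State), c.keeps S = true →
      ∀ y, S y = true → (exec ω c σ).reg y = σ.reg y
  | .skip, σ, _, y, _ => rfl
  | .set x e, σ, h, y, hy => by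
    simp only [Cmd.keeps, Bool.not_eq_true'] at h
    exact setReg_reg_of_ne (by rintro rfl; simp [h] at hy)
  | .put _ _ _ _, σ, _, y, _ => rfl
  | .draw x e, σ, h, y, hy => by
    simp only [Cmd.keeps, Bool.not_eq_true'] at h
    have hne : y ≠ x := by rintro rfl; simp [h] at hy
    simp [exec, run, State.setReg, hne]
  | .seq c d, σ, h, y, hy => by
    simp only [Cmd.keeps, Bool.and_eq_true] at h
    exact (run_reg_of_keeps ω d _ h.2 y hy).trans (run_reg_of_keeps ω c _ h.1 y hy)
  | .ite g c d, σ, h, y, hy => by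
    simp only [Cmd.keeps, Bool.and_eq_true] at h
    by_cases hg : g.eval σ = 0
    · simpa [exec, run, hg] using run_reg_of_keeps ω d σ h.2 y hy
    · simpa [exec, run, hg] using run_reg_of_keeps ω c σ h.1 y hy
  | .loop x e g c, σ, h, y, hy => by
    simp only [Cmd.keeps, Bool.and_eq_true, Bool.not_eq_true'] at h
    have hne : y ≠ x := by rintro rfl; simp [h.1] at hy
    have key : ∀ (m i : ℕ) (ρ : State), (runLoop x g (run ω c) m i ρ).1.reg y = ρ.reg y := by
      intro m
      induction m with
      | zero => intro i ρ; rfl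
      | succ m ih =>
        intro i ρ
        have h1 := setReg_reg_of_ne (σ := ρ) (a := i) hne
        by_cases hg : g.eval (ρ.setReg x i) = 0
        · simp [runLoop, hg, h1]
        · simp only [runLoop, hg, if_false]
          rw [ih, ← h1]
          exact run_reg_of_keeps ω c _ h.2 y hy
    exact key _ _ _

/-- The static bound is correct for programs that do not write the registers in their loop
bounds. -/
theorem time_le_costBound {S : Reg → Bool} {τ : Reg → ℕ} (ω : Draws) :
    ∀ (c : Cmd) (σ : State), c.keeps S = true → c.boundedBy S = true →
      (∀ x, S x = true → σ.reg x ≤ τ x) → time ω c σ ≤ c.costBound τ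
  | .skip, _, _, _, _ => le_rfl
  | .set _ _, _, _, _, _ => le_rfl
  | .put _ _ _ _, _, _, _, _ => le_rfl
  | .draw _ _, _, _, _, _ => le_rfl
  | .seq c d, σ, hk, hb, h => by
    simp only [Cmd.keeps, Cmd.boundedBy, Bool.and_eq_true] at hk hb
    refine Nat.add_le_add (time_le_costBound ω c σ hk.1 hb.1 h)
      (time_le_costBound ω d (exec ω c σ) hk.2 hb.2 fun x hx => ?_)
    rw [run_reg_of_keeps ω c σ hk.1 x hx]
    exact h x hx
  | .ite g c d, σ, hk, hb, h => by
    simp only [Cmd.keeps, Cmd.boundedBy, Bool.and_eq_true] at hk hb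
    have h1 := time_le_costBound ω c σ hk.1 hb.1 h
    have h2 := time_le_costBound ω d σ hk.2 hb.2 h
    refine Nat.add_le_add_left ?_ _
    by_cases hg : g.eval σ = 0
    · simp only [hg, if_true]
      exact h2.trans (Nat.le_add_left _ _)
    · simp only [hg, if_false]
      exact h1.trans (Nat.le_add_right _ _)
  | .loop x e g c, σ, hk, hb, h => by
    have hk' := hk
    simp only [Cmd.keeps, Cmd.boundedBy, Bool.and_eq_true, Bool.not_eq_true'] at hk hb
    have key := runLoop_spec (x := x) (g := g) (body := run ω c)
      (P := fun ρ => ∀ x, S x = true → ρ.reg x ≤ τ x) (T := c.costBound τ)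
      (fun ρ a hρ y hy => by
        rw [setReg_reg_of_ne (by rintro rfl; simp [hk.1] at hy)]
        exact hρ y hy)
      (fun ρ hρ => ⟨fun y hy => by
        have := run_reg_of_keeps ω c ρ hk.2 y hy
        rw [exec] at this
        rw [this]
        exact hρ y hy, time_le_costBound ω c ρ hk.2 hb.2 hρ⟩) (e.eval σ) 0 σ h
    refine Nat.add_le_add_left (key.2.trans (Nat.add_le_add_left (Nat.mul_le_mul_right _ ?_) _)) _
    exact Expr.eval_le_bound h e hb.1

/-! ### Degrees of the static bound -/

/-- The degree of a sum of products in the register `x`. -/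
def Expr.deg (x : Reg) : Expr → ℕ
  | .reg y => if y = x then 1 else 0
  | .op .add e f => max (e.deg x) (f.deg x)
  | .op .mul e f => e.deg x + f.deg x
  | _ => 0

/-- The degree of the static bound in the register `x`. -/
def Cmd.deg (x : Reg) : Cmd → ℕ
  | .seq c d => max (c.deg x) (d.deg x)
  | .ite _ c d => max (c.deg x) (d.deg x)
  | .loop _ e _ c => e.deg x + c.deg x
  | _ => 0

theorem add_le_mul_pow_max {a b a' b' M p q : ℕ} (hM : 1 ≤ M) (ha : a ≤ a' * M ^ p)
    (hb : b ≤ b' * M ^ q) : a + b ≤ (a' + b') * M ^ max p q := by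
  rw [Nat.add_mul]
  exact Nat.add_le_add
    (ha.trans (Nat.mul_le_mul_left _ (Nat.pow_le_pow_right hM (le_max_left _ _))))
    (hb.trans (Nat.mul_le_mul_left _ (Nat.pow_le_pow_right hM (le_max_right _ _))))

/-- A polynomial with natural coefficients is at most its value at `x = 1` times the power of `x`
given by its degree. The maximum with `1` covers `τ x = 0`, where lower powers dominate. -/
theorem Expr.bound_le_mul_pow_deg (τ : Reg → ℕ) (x : Reg) : ∀ e : Expr,
    e.bound τ ≤ e.bound (Function.update τ x 1) * max 1 (τ x) ^ e.deg x
  | .lit c => by simp [Expr.bound, Expr.deg]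
  | .reg y => by
    by_cases h : y = x
    · subst h
      simp [Expr.bound, Expr.deg]
    · simp [Expr.bound, Expr.deg, h]
  | .get _ _ _ => by simp [Expr.bound]
  | .op o e f => by
    have he := bound_le_mul_pow_deg τ x e
    have hf := bound_le_mul_pow_deg τ x f
    cases o <;> simp only [Expr.bound, Expr.deg] <;> try exact Nat.zero_le _
    · exact add_le_mul_pow_max (le_max_left _ _) he hf
    · rw [pow_add, mul_mul_mul_comm]
      exact Nat.mul_le_mul he hf

theorem Cmd.costBound_le_mul_pow_deg (τ : Reg → ℕ) (x : Reg) : ∀ c : Cmd,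
    c.costBound τ ≤ c.costBound (Function.update τ x 1) * max 1 (τ x) ^ c.deg x
  | .skip => by simp [Cmd.costBound, Cmd.deg]
  | .set _ _ => by simp [Cmd.costBound, Cmd.deg]
  | .put _ _ _ _ => by simp [Cmd.costBound, Cmd.deg]
  | .draw _ _ => by simp [Cmd.costBound, Cmd.deg]
  | .seq c d => add_le_mul_pow_max (le_max_left _ _)
      (costBound_le_mul_pow_deg τ x c) (costBound_le_mul_pow_deg τ x d)
  | .ite g c d => by
    have hP : 1 ≤ max 1 (τ x) ^ (Cmd.ite g c d).deg x := Nat.one_le_pow _ _ (by simp)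
    have h : c.costBound τ + d.costBound τ ≤ _ := add_le_mul_pow_max (le_max_left 1 (τ x))
      (costBound_le_mul_pow_deg τ x c) (costBound_le_mul_pow_deg τ x d)
    have h2 := Nat.le_mul_of_pos_right (g.cost + 1) hP
    simp only [Cmd.costBound, Cmd.deg] at h h2 ⊢
    rw [Nat.add_mul]
    exact Nat.add_le_add h2 h
  | .loop y e g c => by
    have hP : ∀ k, 1 ≤ max 1 (τ x) ^ k := fun k => Nat.one_le_pow _ _ (by simp)
    have he := Expr.bound_le_mul_pow_deg τ x e
    have hc := costBound_le_mul_pow_deg τ x c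
    have hc' : g.cost + 2 + c.costBound τ ≤
        (g.cost + 2 + c.costBound (Function.update τ x 1)) * max 1 (τ x) ^ c.deg x := by
      rw [Nat.add_mul]
      exact Nat.add_le_add (Nat.le_mul_of_pos_right _ (hP _)) hc
    simp only [Cmd.costBound, Cmd.deg]
    rw [Nat.add_mul, Nat.add_mul, pow_add, mul_mul_mul_comm]
    have h1 := hP (e.deg x + c.deg x)
    rw [pow_add] at h1
    exact Nat.add_le_add (Nat.le_mul_of_pos_right _ h1)
      (Nat.add_le_add (by simpa using h1) (Nat.mul_le_mul he hc'))

/-! ### The running times of the parts of the algorithm -/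

/-- Upper bounds for the registers that occur in loop bounds. -/
def caps (n r B t : ℕ) : Reg → ℕ
  | .n => n
  | .r => r
  | .b => B
  | .nodes => B * B + B + 2
  | .total => t
  | _ => 0

/-- The growing quantities `n`, `r`, `total` are split off one after the other. The number of boxes
stays in the coefficient, since it is bounded in terms of `δ` alone. -/
theorem costBound_caps_le (c : Cmd) (n r B t : ℕ) :
    c.costBound (caps n r B t) ≤ c.costBound (caps 1 1 B 1) *
      (max 1 n ^ c.deg .n * max 1 r ^ c.deg .r * max 1 t ^ c.deg .total) := by
  have h1 := c.costBound_le_mul_pow_deg (caps n r B t) .n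
  have h2 := c.costBound_le_mul_pow_deg (caps 1 r B t) .r
  have h3 := c.costBound_le_mul_pow_deg (caps 1 1 B t) .total
  have e1 : Function.update (caps n r B t) .n 1 = caps 1 r B t := by
    funext x; cases x <;> rfl
  have e2 : Function.update (caps 1 r B t) .r 1 = caps 1 1 B t := by
    funext x; cases x <;> rfl
  have e3 : Function.update (caps 1 1 B t) .total 1 = caps 1 1 B 1 := by
    funext x; cases x <;> rfl
  rw [e1] at h1
  rw [e2] at h2
  rw [e3] at h3
  calc _ ≤ _ := h1
    _ ≤ _ := Nat.mul_le_mul_right _ (h2.trans (Nat.mul_le_mul_right _ h3))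
    _ = _ := by simp only [caps]; ring

/-- Membership in a list of registers. -/
def among (l : List Reg) (x : Reg) : Bool := decide (x ∈ l)

theorem time_le_of_deg {c : Cmd} {n r : ℕ} {p q : ℕ} (hp : c.deg .n = p) (hq : c.deg .r = q)
    (ht : c.deg .total = 0)
    (hk : c.keeps (among [.n, .r]) = true) (hb : c.boundedBy (among [.n, .r]) = true)
    (hn : 1 ≤ n) (ω : Draws) (σ : State) (h1 : σ.reg .n = n) (h2 : σ.reg .r = r) :
    time ω c σ ≤ c.costBound (caps 1 1 0 1) * (n ^ p * (r + 1) ^ q) := by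
  -- The values `0` for the boxes and `1` for `total` are arbitrary: neither register lies in the
  -- set that the loop bounds may use.
  have h := (time_le_costBound (τ := caps n r 0 1) ω c σ hk hb (by
    intro x hx
    simp only [among, List.mem_cons, List.not_mem_nil, or_false, decide_eq_true_eq] at hx
    rcases hx with rfl | rfl
    · exact h1.le
    · exact h2.le)).trans (costBound_caps_le c n r 0 1)
  rw [hp, hq, ht, max_eq_right hn, pow_zero, mul_one] at h
  exact h.trans (Nat.mul_le_mul_left _ (Nat.mul_le_mul_left _
    (Nat.pow_le_pow_left (by omega) _)))

/-- The constant is found by unification and never computed; the `rfl`s evaluate the degrees and the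
two syntactic conditions. -/
theorem exists_time_selectRoots_le : ∃ D : ℕ, ∀ n r : ℕ, 1 ≤ n → ∀ (ω : Draws) (σ : State),
    σ.reg .n = n → σ.reg .r = r → time ω selectRoots σ ≤ D * (n ^ 1 * (r + 1) ^ 1) :=
  ⟨_, fun _ _ hn ω σ h1 h2 => time_le_of_deg rfl rfl rfl rfl rfl hn ω σ h1 h2⟩

theorem exists_time_bfsFromRoots_le : ∃ D : ℕ, ∀ n r : ℕ, 1 ≤ n → ∀ (ω : Draws) (σ : State),
    σ.reg .n = n → σ.reg .r = r → time ω bfsFromRoots σ ≤ D * (n ^ 2 * (r + 1) ^ 1) :=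
  ⟨_, fun _ _ hn ω σ h1 h2 => time_le_of_deg rfl rfl rfl rfl rfl hn ω σ h1 h2⟩

theorem exists_time_createTable_le : ∃ D : ℕ, ∀ n r : ℕ, 1 ≤ n → ∀ (ω : Draws) (σ : State),
    σ.reg .n = n → σ.reg .r = r → time ω createTable σ ≤ D * (n ^ 1 * (r + 1) ^ 1) :=
  ⟨_, fun _ _ hn ω σ h1 h2 => time_le_of_deg rfl rfl rfl rfl rfl hn ω σ h1 h2⟩

/-! ### Cost of one placement and of one box size -/

theorem time_seq (ω : Draws) (c d : Cmd) (σ : State) :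
    time ω (c ;; d) σ = time ω c σ + time ω d (exec ω c σ) := rfl

theorem exec_seq (ω : Draws) (c d : Cmd) (σ : State) :
    exec ω (c ;; d) σ = exec ω d (exec ω c σ) := rfl

/-- The node count is set to the right value at the start of `createNetwork`. -/
theorem createNetwork_spec {n r B t : ℕ} (ω : Draws) (σ : State)
    (h1 : σ.reg .n = n) (hB : σ.reg .b ≤ B) :
    time ω createNetwork σ ≤ createNetwork.costBound (caps n r B t) ∧
      (exec ω createNetwork σ).reg .nodes ≤ B * B + B + 2 := by
  set σ' := exec ω (.set .nodes (Reg.src + 2)) (exec ω (.set .snk (Reg.src + 1))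
    (exec ω (.set .src (Reg.b * Reg.b + Reg.b)) σ)) with hσ'
  have hN : σ'.reg .nodes ≤ B * B + B + 2 := by
    change σ.reg .b * σ.reg .b + σ.reg .b + 2 ≤ _
    gcongr
  have hn' : σ'.reg .n = n := h1
  have hb' : σ'.reg .b ≤ B := hB
  -- After the three assignments only bounds on `n`, `b` and `nodes` are needed, and the remaining
  -- program writes none of these registers.
  clear_value σ'
  unfold createNetwork
  simp only [time_seq _ (Cmd.set _ _), exec_seq _ (Cmd.set _ _)]
  rw [← hσ']
  constructor
  · refine Nat.add_le_add le_rfl (Nat.add_le_add le_rfl (Nat.add_le_add le_rfl ?_))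
    refine time_le_costBound (S := among [.n, .b, .nodes]) ω _ _ rfl rfl ?_
    intro x hx
    simp only [among, List.mem_cons, List.not_mem_nil, or_false, decide_eq_true_eq] at hx
    rcases hx with rfl | rfl | rfl
    · exact hn'.le
    · exact hb'
    · exact hN
  · rw [run_reg_of_keeps (S := among [.nodes]) ω _ _ rfl _ rfl]
    exact hN

/-- The body of the loop over the placements of the roots. -/
def tryPlacement : Cmd :=
  placeRoots ;;
  updateIntervals ;;
  createNetwork ;;
  maxFlow ;;
  .when (.op .eq Reg.flow Reg.n) (convert ;; .set .found 1)

/-- The static bound does not apply to the whole body, because `createNetwork` writes `nodes`, which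
bounds the loops of `maxFlow`. The five parts are bounded separately and the bounds add up to
`costBound` of the body. -/
theorem time_tryPlacement_le {n r B t : ℕ} (ω : Draws) (σ : State)
    (h1 : σ.reg .n = n) (h2 : σ.reg .r = r) (hB : σ.reg .b ≤ B) :
    time ω tryPlacement σ ≤ tryPlacement.costBound (caps n r B t) := by
  have hcaps : ∀ ρ : State, ρ.reg .n = n → ρ.reg .r = r → ρ.reg .b ≤ B →
      ∀ x, among [.n, .r, .b] x = true → ρ.reg x ≤ caps n r B t x := by
    intro ρ a1 a2 a3 x hx
    simp only [among, List.mem_cons, List.not_mem_nil, or_false, decide_eq_true_eq] at hx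
    rcases hx with rfl | rfl | rfl
    · exact a1.le
    · exact a2.le
    · exact a3
  have keep : ∀ (c : Cmd) (ρ : State), c.keeps (among [.n, .r, .b]) = true →
      (ρ.reg .n = n ∧ ρ.reg .r = r ∧ ρ.reg .b ≤ B) →
      ((exec ω c ρ).reg .n = n ∧ (exec ω c ρ).reg .r = r ∧ (exec ω c ρ).reg .b ≤ B) := by
    intro c ρ hc h
    have := run_reg_of_keeps ω c ρ hc
    rw [this .n rfl, this .r rfl, this .b rfl]
    exact h
  have s1 := keep placeRoots σ rfl ⟨h1, h2, hB⟩
  have s2 := keep updateIntervals _ rfl s1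
  have s3 := keep createNetwork _ rfl s2
  have s4 := keep maxFlow _ rfl s3
  have hN := createNetwork_spec (r := r) (t := t) ω _ s2.1 s2.2.2
  have hM : time ω maxFlow (exec ω createNetwork (exec ω updateIntervals (exec ω placeRoots σ))) ≤
      maxFlow.costBound (caps n r B t) := by
    refine time_le_costBound (S := among [.nodes]) ω _ _ rfl rfl ?_
    intro x hx
    simp only [among, List.mem_cons, List.not_mem_nil, or_false, decide_eq_true_eq] at hx
    subst hx
    exact hN.2
  have hP := time_le_costBound ω placeRoots σ rfl rfl (hcaps _ h1 h2 hB)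
  have hU := time_le_costBound ω updateIntervals _ rfl rfl (hcaps _ s1.1 s1.2.1 s1.2.2)
  have hC := time_le_costBound ω (.when (.op .eq Reg.flow Reg.n) (convert ;; .set .found 1)) _
    rfl rfl (hcaps _ s4.1 s4.2.1 s4.2.2)
  unfold tryPlacement
  rw [time_seq, time_seq, time_seq, time_seq]
  simp only [Cmd.costBound] at hC ⊢
  exact Nat.add_le_add hP <| Nat.add_le_add hU <| Nat.add_le_add hN.1 <| Nat.add_le_add hM hC

/-- A loop without exit condition multiplies `total` by at most `B ^ r`. -/
theorem runLoop_total_le (ω : Draws) {B : ℕ} : ∀ (m i : ℕ) (σ : State), σ.reg .b ≤ B →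
    (runLoop .k 1 (run ω (.set .total (Reg.total * Reg.b))) m i σ).1.reg .total
      ≤ σ.reg .total * B ^ m
  | 0, _, σ, _ => by simp [runLoop]
  | m + 1, i, σ, h => by
    have h1 : (1 : Expr).eval (σ.setReg .k i) ≠ 0 := Nat.one_ne_zero
    simp only [runLoop, h1, if_false]
    refine (runLoop_total_le ω m (i + 1) _ (by exact h)).trans ?_
    change σ.reg .total * σ.reg .b * B ^ m ≤ _
    rw [pow_succ', ← mul_assoc]
    exact Nat.mul_le_mul_right _ (Nat.mul_le_mul_left _ h)

/-- The cost has degree one in each of `n`, `r` and `total`, and `total ≤ B ^ r` once the product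
has been formed. The static bound is used only after `b` and `total` have been assigned. -/
theorem time_testBoxSize_le {n r B : ℕ} (hn : 1 ≤ n) (hB : 1 ≤ B) (ω : Draws) (σ : State)
    (h1 : σ.reg .n = n) (h2 : σ.reg .r = r)
    (hb : (n + σ.reg .s - 1) / σ.reg .s ≤ B) :
    time ω testBoxSize σ ≤ testBoxSize.costBound (caps 1 1 B 1) * (n * (r + 1) * B ^ r) := by
  have key : time ω testBoxSize σ ≤ testBoxSize.costBound (caps n r B (B ^ r)) := by
    set σ₁ := exec ω (.set .total 1)
      (exec ω (.set .b ((Reg.n + Reg.s - 1) / Reg.s)) σ) with hσ₁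
    have a1 : σ₁.reg .n = n := h1
    have a2 : σ₁.reg .r = r := h2
    have a3 : σ₁.reg .b ≤ B := by subst h1; exact hb
    have a4 : σ₁.reg .total = 1 := rfl
    clear_value σ₁
    set C₁ : Cmd := .for .k Reg.r (.set .total (Reg.total * Reg.b)) with hC₁
    set σ₂ := exec ω (.set .found 0) (exec ω C₁ σ₁) with hσ₂
    have kp := run_reg_of_keeps (S := among [.n, .r, .b]) ω C₁ σ₁ rfl
    have b1 : σ₂.reg .n = n := (kp .n rfl).trans a1
    have b2 : σ₂.reg .r = r := (kp .r rfl).trans a2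
    have b3 : σ₂.reg .b ≤ B := (kp .b rfl).trans_le a3
    have b4 : σ₂.reg .total ≤ B ^ r := by
      have := runLoop_total_le ω (σ₁.reg .r) 0 σ₁ a3
      rw [a4, one_mul, a2] at this
      refine le_trans (le_of_eq ?_) this
      rw [← a2]
      rfl
    clear_value σ₂
    unfold testBoxSize
    rw [time_seq, time_seq, time_seq, time_seq]
    rw [← hσ₁, ← hC₁, ← hσ₂]
    refine Nat.add_le_add le_rfl <| Nat.add_le_add le_rfl <| Nat.add_le_add ?_ <|
      Nat.add_le_add le_rfl ?_
    · refine time_le_costBound (S := among [.r]) ω _ _ rfl rfl ?_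
      intro x hx
      simp only [among, List.mem_cons, List.not_mem_nil, or_false, decide_eq_true_eq] at hx
      subst hx
      exact a2.le
    · have := runLoop_spec (x := .p) (g := .op .eq Reg.found 0) (body := run ω tryPlacement)
        (P := fun ρ => ρ.reg .n = n ∧ ρ.reg .r = r ∧ ρ.reg .b ≤ B)
        (T := tryPlacement.costBound (caps n r B (B ^ r)))
        (fun ρ a h => h)
        (fun ρ h => ⟨by
          have := run_reg_of_keeps (S := among [.n, .r, .b]) ω tryPlacement ρ rfl
          rw [exec] at this
          rw [this .n rfl, this .r rfl, this .b rfl]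
          exact h, time_tryPlacement_le ω ρ h.1 h.2.1 h.2.2⟩)
        (σ₂.reg .total) 0 σ₂ ⟨b1, b2, b3⟩
      exact Nat.add_le_add_left (this.2.trans
        (Nat.add_le_add_left (Nat.mul_le_mul_right _ b4) _)) _
  refine (key.trans (costBound_caps_le _ _ _ _ _)).trans (Nat.mul_le_mul_left _ ?_)
  have d1 : testBoxSize.deg .n = 1 := rfl
  have d2 : testBoxSize.deg .r = 1 := rfl
  have d3 : testBoxSize.deg .total = 1 := rfl
  rw [d1, d2, d3, pow_one, pow_one, pow_one, max_eq_right hn,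
    max_eq_right (Nat.one_le_pow _ _ hB)]
  gcongr
  omega

/-! ### The binary search -/

/-- What happens to the range of box sizes after a box size has been tested. -/
def updateRange : Cmd :=
  .ite Reg.found (.set .hi (Reg.s - 1) ;; .set .success 1) (.set .lo (Reg.s + 1))

/-- The body of the binary search. -/
def searchStep : Cmd :=
  .set .s ((Reg.lo + Reg.hi) / 2) ;; testBoxSize ;; updateRange

theorem time_updateRange_le (ω : Draws) (σ : State) : time ω updateRange σ ≤ 12 :=
  time_le_costBound (S := fun _ => false) (τ := fun _ => 0) ω updateRange σ rfl rfl (by simp)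

theorem updateRange_range (ω : Draws) (σ : State) :
    ((exec ω updateRange σ).reg .lo = σ.reg .lo ∧
        (exec ω updateRange σ).reg .hi = σ.reg .s - 1) ∨
      ((exec ω updateRange σ).reg .lo = σ.reg .s + 1 ∧
        (exec ω updateRange σ).reg .hi = σ.reg .hi) := by
  by_cases h : (Reg.found : Expr).eval σ = 0
  · right
    simp only [exec, updateRange, run, h, if_true]
    exact ⟨rfl, rfl⟩
  · left
    simp only [exec, updateRange, run, h, if_false]
    exact ⟨rfl, rfl⟩

/-- One step of the binary search: it takes the time of one test, and halves the range. -/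
theorem searchStep_spec {n r B l h : ℕ} (hn : 1 ≤ n) (hB : 1 ≤ B) (hl : 1 ≤ l)
    (hs : ∀ s, l ≤ s → s ≤ h → (n + s - 1) / s ≤ B) (ω : Draws) (σ : State)
    (h1 : σ.reg .n = n) (h2 : σ.reg .r = r) (h3 : l ≤ σ.reg .lo) (h4 : σ.reg .hi ≤ h)
    (h5 : σ.reg .lo ≤ σ.reg .hi) (k : ℕ) (h6 : σ.reg .hi + 1 < σ.reg .lo + 2 ^ (k + 1)) :
    (exec ω searchStep σ).reg .n = n ∧ (exec ω searchStep σ).reg .r = r ∧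
      l ≤ (exec ω searchStep σ).reg .lo ∧ (exec ω searchStep σ).reg .hi ≤ h ∧
      (exec ω searchStep σ).reg .hi + 1 < (exec ω searchStep σ).reg .lo + 2 ^ k ∧
      time ω searchStep σ ≤ 18 + testBoxSize.costBound (caps 1 1 B 1) * (n * (r + 1) * B ^ r) := by
  set σ₁ := exec ω (.set .s ((Reg.lo + Reg.hi) / 2)) σ with hσ₁
  have a1 : σ₁.reg .n = n := h1
  have a2 : σ₁.reg .r = r := h2
  have a3 : σ₁.reg .lo = σ.reg .lo := rfl
  have a4 : σ₁.reg .hi = σ.reg .hi := rfl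
  have a5 : σ₁.reg .s = (σ.reg .lo + σ.reg .hi) / 2 := rfl
  clear_value σ₁
  set σ₂ := exec ω testBoxSize σ₁ with hσ₂
  have kp := run_reg_of_keeps (S := among [.n, .r, .s, .lo, .hi]) ω testBoxSize σ₁ rfl
  rw [← hσ₂] at kp
  have b1 := (kp .n rfl).trans a1
  have b2 := (kp .r rfl).trans a2
  have b3 := (kp .lo rfl).trans a3
  have b4 := (kp .hi rfl).trans a4
  have b5 := (kp .s rfl).trans a5
  have hT := time_testBoxSize_le hn hB ω σ₁ a1 a2 (hs _ (by omega) (by omega))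
  clear_value σ₂
  have hE : exec ω searchStep σ = exec ω updateRange σ₂ := by
    rw [hσ₂, hσ₁]; rfl
  have hTime : time ω searchStep σ = 6 + (time ω testBoxSize σ₁ + time ω updateRange σ₂) := by
    unfold searchStep
    rw [time_seq, time_seq, ← hσ₁, ← hσ₂]
    rfl
  have hU := time_updateRange_le ω σ₂
  have kq := run_reg_of_keeps (S := among [.n, .r]) ω updateRange σ₂ rfl
  rw [hE, kq .n rfl, kq .r rfl]
  have h2k : 2 ^ (k + 1) = 2 ^ k + 2 ^ k := by ring
  -- With `s` the midpoint, `s - lo` or `hi - s` sizes remain, fewer than `2 ^ k` in either case.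
  -- Since `s ≥ lo ≥ 1`, the subtraction in `s - 1` is not truncated.
  refine ⟨b1, b2, ?_, ?_, ?_, by omega⟩ <;>
    rcases updateRange_range ω σ₂ with ⟨c1, c2⟩ | ⟨c1, c2⟩ <;> omega

/-- The range has fewer than `2 ^ k` elements, so at most `k` rounds occur, whatever the formal loop
bound `m` is. The `5` pays for the final check of the exit condition, and `23` is that check plus
the `18` of a round. -/
theorem time_searchLoop_le {n r B l h : ℕ} (hn : 1 ≤ n) (hB : 1 ≤ B) (hl : 1 ≤ l)
    (hs : ∀ s, l ≤ s → s ≤ h → (n + s - 1) / s ≤ B) (ω : Draws) :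
    ∀ (m i k : ℕ) (σ : State), σ.reg .n = n → σ.reg .r = r → l ≤ σ.reg .lo → σ.reg .hi ≤ h →
      σ.reg .hi + 1 < σ.reg .lo + 2 ^ k →
      (runLoop .phase (.op .le Reg.lo Reg.hi) (run ω searchStep) m i σ).2 ≤
        5 + k * (23 + testBoxSize.costBound (caps 1 1 B 1) * (n * (r + 1) * B ^ r))
  | 0, i, k, σ, _, _, _, _, _ => by simp only [runLoop]; omega
  | m + 1, i, k, σ, h1, h2, h3, h4, h5 => by
    have hg : (Expr.op .le Reg.lo Reg.hi).eval (σ.setReg .phase i) =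
      if σ.reg .lo ≤ σ.reg .hi then 1 else 0 := rfl
    have hc : (Expr.op .le Reg.lo Reg.hi).cost = 3 := rfl
    by_cases hlh : σ.reg .lo ≤ σ.reg .hi
    · rw [if_pos hlh] at hg
      cases k with
      | zero => omega
      | succ k =>
        have st := searchStep_spec (r := r) hn hB hl hs ω (σ.setReg .phase i) h1 h2 h3 h4 hlh k h5
        have ih := time_searchLoop_le hn hB hl hs ω m (i + 1) k _ st.1 st.2.1 st.2.2.1 st.2.2.2.1
          st.2.2.2.2.1
        simp only [runLoop, hg, hc]
        rw [if_neg Nat.one_ne_zero]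
        have := st.2.2.2.2.2
        simp only [time, exec] at this ih
        rw [Nat.add_mul]
        dsimp only
        omega
    · rw [if_neg hlh] at hg
      simp only [runLoop, hg, hc, if_true]
      omega

theorem time_searchLayout_le {n r B l : ℕ} (hn : 1 ≤ n) (hB : 1 ≤ B) (hl : 1 ≤ l)
    (hs : ∀ s, l ≤ s → s ≤ n / 2 → (n + s - 1) / s ≤ B) (ω : Draws) (k : ℕ)
    (hk : n / 2 + 1 < l + 2 ^ k) (σ : State)
    (h1 : σ.reg .n = n) (h2 : σ.reg .r = r) (h3 : σ.reg .smin = l) :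
    time ω searchLayout σ ≤
      20 + k * (23 + testBoxSize.costBound (caps 1 1 B 1) * (n * (r + 1) * B ^ r)) := by
  set σ₁ := exec ω (.set .success 0) (exec ω (.set .hi (Reg.n / 2))
    (exec ω (.set .lo Reg.smin) σ)) with hσ₁
  have a1 : σ₁.reg .n = n := h1
  have a2 : σ₁.reg .r = r := h2
  have a3 : σ₁.reg .lo = l := h3
  have a4 : σ₁.reg .hi = n / 2 := by subst h1; rfl
  clear_value σ₁
  have := time_searchLoop_le (r := r) hn hB hl hs ω (σ₁.reg .n) 0 k σ₁ a1 a2 a3.ge a4.le (by omega)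
  have hT : time ω searchLayout σ = 2 + (4 + (2 + (1 +
      (runLoop .phase (.op .le Reg.lo Reg.hi) (run ω searchStep) (σ₁.reg .n) 0 σ₁).2))) := by
    unfold searchLayout
    rw [time_seq, time_seq, time_seq, ← hσ₁]
    rfl
  omega

/-- Hides the coefficient of the static bound; what matters is that it depends on `B` only. -/
theorem exists_time_searchLayout_le_mul {B : ℕ} (hB : 1 ≤ B) : ∃ D : ℕ, ∀ n r l : ℕ, 1 ≤ n →
    1 ≤ l → (∀ s, l ≤ s → s ≤ n / 2 → (n + s - 1) / s ≤ B) → ∀ (ω : Draws) (k : ℕ),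
    n / 2 + 1 < l + 2 ^ k → ∀ σ : State, σ.reg .n = n → σ.reg .r = r → σ.reg .smin = l →
    time ω searchLayout σ ≤ 20 + k * (23 + D * (n * (r + 1) * B ^ r)) :=
  ⟨_, fun _ _ _ hn hl hs ω k hk σ h1 h2 h3 => time_searchLayout_le hn hB hl hs ω k hk σ h1 h2 h3⟩

/-! ### The states between the steps of the algorithm -/

theorem stateSearch_reg {n : ℕ} (ω : Draws) (δ : ℝ) (G : SimpleGraph (Fin n))
    [DecidableRel G.Adj] (r : ℕ) :
    (∀ y, among [.n, .r, .smin] y = true →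
        (stateBfs ω δ G r).reg y = (input δ G r).reg y) ∧
      (∀ y, among [.n, .r, .smin] y = true →
        (stateTable ω δ G r).reg y = (input δ G r).reg y) ∧
      (∀ y, among [.n, .r, .smin] y = true →
        (stateSearch ω δ G r).reg y = (input δ G r).reg y) := by
  have k1 := run_reg_of_keeps (S := among [.n, .r, .smin]) ω selectRoots (input δ G r) rfl
  have k2 := run_reg_of_keeps (S := among [.n, .r, .smin]) ω bfsFromRoots (stateBfs ω δ G r) rfl
  have k3 := run_reg_of_keeps (S := among [.n, .r, .smin]) ω createTable (stateTable ω δ G r) rfl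
  exact ⟨k1, fun y hy => (k2 y hy).trans (k1 y hy),
    fun y hy => (k3 y hy).trans ((k2 y hy).trans (k1 y hy))⟩

theorem time_algorithm2 {n : ℕ} (ω : Draws) (δ : ℝ) (G : SimpleGraph (Fin n))
    [DecidableRel G.Adj] (r : ℕ) :
    time ω algorithm2 (input δ G r) = time ω selectRoots (input δ G r) +
      (time ω bfsFromRoots (stateBfs ω δ G r) + (time ω createTable (stateTable ω δ G r) +
        time ω searchLayout (stateSearch ω δ G r))) := rfl

/-! ### Estimates -/

theorem loglog_three_pos : 0 < Real.log (Real.log 3) := by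
  apply Real.log_pos
  rw [Real.lt_log_iff_exp_lt (by norm_num)]
  linarith [Real.exp_one_lt_d9]

theorem one_lt_log {n : ℕ} (hn : 3 ≤ n) : 1 < Real.log n := by
  have h3 : (3 : ℝ) ≤ n := by exact_mod_cast hn
  rw [Real.lt_log_iff_exp_lt (by linarith)]
  linarith [Real.exp_one_lt_d9]

theorem loglog_three_le {n : ℕ} (hn : 3 ≤ n) :
    Real.log (Real.log 3) ≤ Real.log (Real.log n) := by
  have h3 : (3 : ℝ) ≤ n := by exact_mod_cast hn
  have : 0 < Real.log 3 := Real.log_pos (by norm_num)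
  gcongr

/-- The number of roots plus one is `O(log log n)`. -/
theorem card_roots_le {a : ℝ} {n r : ℕ} (hn : 3 ≤ n) (hr : (r : ℝ) ≤ a * Real.log (Real.log n)) :
    (r : ℝ) + 1 ≤ (a + (Real.log (Real.log 3))⁻¹) * Real.log (Real.log n) := by
  have h3 := loglog_three_pos
  have h : 1 ≤ (Real.log (Real.log 3))⁻¹ * Real.log (Real.log n) := by
    rw [inv_mul_eq_div, one_le_div h3]
    exact loglog_three_le hn
  linarith

/-- Powers of the logarithm are at most linear. -/
theorem log_rpow_le {E : ℝ} (hE : 0 ≤ E) {n : ℕ} (hn : 3 ≤ n) :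
    Real.log n ^ E ≤ (E + 1) ^ (E + 1) * n := by
  have hL := one_lt_log hn
  have hn0 : (0 : ℝ) ≤ n := Nat.cast_nonneg n
  have hE1 : 0 < E + 1 := by linarith
  -- Uses `log n ≤ n ^ c / c` with `c = 1 / (E + 1)`; the shift by one keeps `c` defined when `E =
  -- 0`.
  calc Real.log n ^ E ≤ Real.log n ^ (E + 1) :=
        Real.rpow_le_rpow_of_exponent_le hL.le (by linarith)
    _ ≤ ((n : ℝ) ^ (1 / (E + 1)) / (1 / (E + 1))) ^ (E + 1) :=
        Real.rpow_le_rpow (by linarith) (Real.log_le_rpow_div hn0 (by positivity)) hE1.le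
    _ = (E + 1) ^ (E + 1) * n := by
        rw [div_div_eq_mul_div, div_one, Real.mul_rpow (by positivity) hE1.le,
          ← Real.rpow_mul hn0, one_div_mul_cancel hE1.ne', Real.rpow_one, mul_comm]

/-- Powers of the logarithm are sublinear. -/
theorem exists_log_rpow_le (E : ℝ) {ε : ℝ} (hε : 0 < ε) :
    ∃ N : ℕ, ∀ n : ℕ, N ≤ n → Real.log n ^ E ≤ ε * n := by
  have h := (isLittleO_log_rpow_rpow_atTop E (zero_lt_one' ℝ)).comp_tendsto
    tendsto_natCast_atTop_atTop
  have h2 := h.def hε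
  rw [Filter.eventually_atTop] at h2
  obtain ⟨N, hN⟩ := h2
  refine ⟨N, fun n hn => ?_⟩
  have := hN n hn
  simp only [Function.comp, Real.rpow_one, Real.norm_natCast] at this
  exact (le_abs_self _).trans this

/-- For `x ≥ 2`, `⌈x⌉ < x + 1 ≤ x²`. A power of `1/δ` is wanted so that the logarithm of the number
of boxes becomes a multiple of `log (1/δ)`; near `δ = 1` this fails. -/
theorem ceil_one_div_le_sq {δ : ℝ} (h0 : 0 < δ) (h2 : δ ≤ 1 / 2) :
    (⌈1 / δ⌉₊ : ℝ) ≤ (1 / δ) ^ 2 := by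
  have hx : 2 ≤ 1 / δ := by
    rw [le_div_iff₀ h0]
    linarith
  have := Nat.ceil_lt_add_one (a := 1 / δ) (by positivity)
  nlinarith

/-- The number of placements of the roots. -/
theorem placements_le {A δ : ℝ} (h0 : 0 < δ) (h2 : δ ≤ 1 / 2) {n r : ℕ}
    (hn : 3 ≤ n) (hr : (r : ℝ) ≤ A * (1 / δ) * Real.log (Real.log n)) :
    (⌈1 / δ⌉₊ : ℝ) ^ r ≤ Real.log n ^ (2 * A * ((1 / δ) * Real.log (1 / δ))) := by
  have hx : 0 < 1 / δ := by positivity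
  have hlx : 0 ≤ Real.log (1 / δ) := Real.log_nonneg (by rw [le_div_iff₀ h0]; linarith)
  calc (⌈1 / δ⌉₊ : ℝ) ^ r ≤ ((1 / δ) ^ 2) ^ r := by
        gcongr
        exact ceil_one_div_le_sq h0 h2
    _ = Real.exp (r * (2 * Real.log (1 / δ))) := by
        rw [← Real.exp_log (pow_pos (pow_pos hx 2) r), Real.log_pow, Real.log_pow]
        norm_num
    _ ≤ Real.exp (A * (1 / δ) * Real.log (Real.log n) * (2 * Real.log (1 / δ))) := by gcongr
    _ = _ := by
        rw [Real.rpow_def_of_pos (by linarith [one_lt_log hn])]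
        congr 1
        ring

/-- From `2 log 2 > 1`. It allows a further factor `log n` to be absorbed by raising the constant in
the exponent by one. -/
theorem one_le_mul_log {δ : ℝ} (h0 : 0 < δ) (h2 : δ ≤ 1 / 2) :
    1 ≤ (1 / δ) * Real.log (1 / δ) := by
  have hx : 2 ≤ 1 / δ := by
    rw [le_div_iff₀ h0]
    linarith
  have hl : Real.log 2 ≤ Real.log (1 / δ) := Real.log_le_log (by norm_num) hx
  nlinarith [Real.log_two_gt_d9]

theorem natLog_add_one_le {n : ℕ} (hn : 3 ≤ n) : ((Nat.log 2 n + 1 : ℕ) : ℝ) ≤ 3 * Real.log n := by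
  have hL := one_lt_log hn
  have h := Real.natLog_le_logb n 2
  have h2 := Real.log_two_gt_d9
  have h3 : Real.logb 2 n ≤ 2 * Real.log n := by
    rw [Real.logb, div_le_iff₀ (by linarith)]
    nlinarith
  push_cast at h ⊢
  linarith

/-- The number of boxes is at most `⌈1 / δ⌉`. -/
theorem le_mul_ceil {δ : ℝ} (h0 : 0 < δ) {n s : ℕ} (hs : δ * n ≤ s) : n ≤ s * ⌈1 / δ⌉₊ := by
  have h := Nat.le_ceil (1 / δ)
  have h1 : (n : ℝ) ≤ s * (1 / δ) := by
    rw [mul_one_div, le_div_iff₀ h0, mul_comm]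
    exact hs
  have h2 : (n : ℝ) ≤ s * (⌈1 / δ⌉₊ : ℝ) :=
    h1.trans (mul_le_mul_of_nonneg_left h (Nat.cast_nonneg s))
  exact_mod_cast h2

theorem ceil_div_pow_le {A δ : ℝ} (h0 : 0 < δ) {n r s : ℕ} (hn : 3 ≤ n)
    (hr : (r : ℝ) ≤ A * (1 / δ) * Real.log (Real.log n)) (hs : δ * n ≤ s)
    (hs2 : (s : ℝ) ≤ n / 2) :
    (⌈(n : ℝ) / s⌉₊ : ℝ) ^ r ≤
      Real.log n ^ ((2 * A + 1) * ((1 / δ) * Real.log (1 / δ))) := by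
  have hn0 : (0 : ℝ) < n := by
    have : 0 < n := by omega
    exact_mod_cast this
  -- Forced by the existence of a box size with `δ n ≤ s ≤ n / 2`.
  have h2 : δ ≤ 1 / 2 := by
    by_contra hc
    push Not at hc
    nlinarith
  have hs0 : (0 : ℝ) < s := lt_of_lt_of_le (by positivity) hs
  have hB : ⌈(n : ℝ) / s⌉₊ ≤ ⌈1 / δ⌉₊ := by
    apply Nat.ceil_le_ceil
    rw [div_le_div_iff₀ hs0 h0]
    linarith
  have hx := one_le_mul_log h0 h2
  calc (⌈(n : ℝ) / s⌉₊ : ℝ) ^ r ≤ (⌈1 / δ⌉₊ : ℝ) ^ r := by gcongr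
    _ ≤ _ := placements_le h0 h2 hn hr
    _ ≤ _ := Real.rpow_le_rpow_of_exponent_le (one_lt_log hn).le (by linarith)

/-- The time of the search for a layout. -/
theorem exists_time_searchLayout_le {A δ : ℝ} (hA : 0 < A) (h0 : 0 < δ) (h1 : δ < 1) :
    ∃ C : ℝ, 0 < C ∧ ∀ n : ℕ, 3 ≤ n → ∀ (G : SimpleGraph (Fin n)) [DecidableRel G.Adj],
      ∀ r : ℕ, (r : ℝ) ≤ A * (1 / δ) * Real.log (Real.log n) → ∀ ω : Draws,
        (time ω searchLayout (stateSearch ω δ G r) : ℝ) ≤ C * (n * Real.log (Real.log n)) *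
          Real.log n ^ ((2 * A + 1) * ((1 / δ) * Real.log (1 / δ))) := by
  have hl3 := loglog_three_pos
  have hlx : 0 ≤ Real.log (1 / δ) := Real.log_nonneg (by rw [le_div_iff₀ h0]; linarith)
  have reg : ∀ (n : ℕ) (G : SimpleGraph (Fin n)) [DecidableRel G.Adj] (r : ℕ) (ω : Draws),
      (stateSearch ω δ G r).reg .n = n ∧ (stateSearch ω δ G r).reg .r = r ∧
        (stateSearch ω δ G r).reg .smin = ⌈δ * (n : ℝ)⌉₊ := fun n G _ r ω =>
    have h := (stateSearch_reg ω δ G r).2.2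
    ⟨h _ rfl, h _ rfl, h _ rfl⟩
  by_cases h2 : δ ≤ 1 / 2
  · set B := ⌈1 / δ⌉₊ with hBdef
    have hB : 1 ≤ B := Nat.ceil_pos.2 (by positivity)
    obtain ⟨D, hD⟩ := exists_time_searchLayout_le_mul hB
    -- The `3` comes from at most `3 log n` rounds, `43 = 20 + 23` merges the additive constants of
    -- the search, and the last factor bounds `(r + 1) / log log n`.
    refine ⟨3 * (43 + D) * (A * (1 / δ) + (Real.log (Real.log 3))⁻¹), by positivity, ?_⟩
    intro n hn G _ r hr ω
    obtain ⟨e1, e2, e3⟩ := reg n G r ω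
    have hn0 : (0 : ℝ) < n := by
      have : 0 < n := by omega
      exact_mod_cast this
    have hl : 1 ≤ ⌈δ * (n : ℝ)⌉₊ := Nat.ceil_pos.2 (by positivity)
    have hk : n / 2 + 1 < ⌈δ * (n : ℝ)⌉₊ + 2 ^ (Nat.log 2 n + 1) := by
      have := Nat.lt_pow_succ_log_self (b := 2) (by norm_num) n
      rw [Nat.succ_eq_add_one] at this
      omega
    have hs : ∀ s, ⌈δ * (n : ℝ)⌉₊ ≤ s → s ≤ n / 2 → (n + s - 1) / s ≤ B := by
      intro s hs _
      have h := le_mul_ceil h0 (n := n) (s := s) (Nat.ceil_le.1 hs)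
      rw [← hBdef] at h
      rw [← Nat.lt_succ_iff, Nat.div_lt_iff_lt_mul (by omega), Nat.succ_eq_add_one, Nat.add_mul,
        mul_comm]
      omega
    have hT := hD n r _ (by omega) hl hs ω _ hk _ e1 e2 e3
    set k := Nat.log 2 n + 1
    have hkL : (k : ℝ) ≤ 3 * Real.log n := natLog_add_one_le hn
    have hP : 1 ≤ n * (r + 1) * B ^ r :=
      Nat.mul_pos (Nat.mul_pos (by omega) (by omega)) (Nat.pow_pos hB)
    have hT2 : time ω searchLayout (stateSearch ω δ G r) ≤
        k * ((43 + D) * (n * (r + 1) * B ^ r)) := by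
      refine hT.trans ?_
      have hk1 : 1 ≤ k := by omega
      nlinarith [Nat.mul_le_mul hk1 hP]
    have hL := one_lt_log hn
    have hM : 0 < Real.log (Real.log n) := Real.log_pos hL
    have hx := one_le_mul_log h0 h2
    set E := (1 / δ) * Real.log (1 / δ) with hE
    calc (time ω searchLayout (stateSearch ω δ G r) : ℝ)
        ≤ k * ((43 + D) * (n * (r + 1) * (B : ℝ) ^ r)) := by exact_mod_cast hT2
      _ ≤ (3 * Real.log n) * ((43 + D) * (n * ((A * (1 / δ) + (Real.log (Real.log 3))⁻¹) *
            Real.log (Real.log n)) * Real.log n ^ (2 * A * E))) := by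
          gcongr
          · exact card_roots_le hn hr
          · exact placements_le h0 h2 hn hr
      -- The `+ 1` in the exponent is the `log n` of the binary search; it is absorbed below by `(1
      -- / δ) * Real.log (1 / δ) ≥ 1`.
      _ = 3 * (43 + D) * (A * (1 / δ) + (Real.log (Real.log 3))⁻¹) *
            (n * Real.log (Real.log n)) * Real.log n ^ (2 * A * E + 1) := by
          rw [Real.rpow_add_one (by linarith)]
          ring
      _ ≤ _ := by
          gcongr
          · exact hL.le
          · linarith
  -- Now `⌈δ n⌉ > n / 2`: the range is empty, so `k = 0` rounds suffice and the bound `B = 1` on the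
  -- number of boxes holds vacuously. The constant `20` is compared with `log log n ≥ log log 3 >
  -- 0`.
  · push Not at h2
    obtain ⟨D, hD⟩ := exists_time_searchLayout_le_mul le_rfl
    refine ⟨20 / Real.log (Real.log 3), by positivity, ?_⟩
    intro n hn G _ r hr ω
    obtain ⟨e1, e2, e3⟩ := reg n G r ω
    have hn1 : (1 : ℝ) ≤ n := by
      have : 1 ≤ n := by omega
      exact_mod_cast this
    have hl : 1 ≤ ⌈δ * (n : ℝ)⌉₊ := Nat.ceil_pos.2 (by positivity)
    have hlt : n / 2 < ⌈δ * (n : ℝ)⌉₊ := by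
      rw [Nat.lt_ceil]
      have : ((n / 2 : ℕ) : ℝ) ≤ n / 2 := Nat.cast_div_le
      nlinarith
    have hT := hD n r _ (by omega) hl
      (fun s hs hs' => absurd hs (by omega)) ω 0 (by rw [pow_zero]; omega) _ e1 e2 e3
    rw [Nat.zero_mul] at hT
    have hL := one_lt_log hn
    have hpow : 1 ≤ Real.log n ^ ((2 * A + 1) * ((1 / δ) * Real.log (1 / δ))) :=
      Real.one_le_rpow hL.le (by positivity)
    calc (time ω searchLayout (stateSearch ω δ G r) : ℝ) ≤ 20 := by exact_mod_cast hT
      _ = 20 / Real.log (Real.log 3) * (1 * Real.log (Real.log 3)) * 1 := by field_simp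
      _ ≤ _ := by
        have := loglog_three_le hn
        have : 0 ≤ Real.log (Real.log n) := hl3.le.trans this
        gcongr

end Bandwidth

/-! ### Assembly of the time bounds -/

theorem lemma7 (A : ℝ) (hA : 0 < A) :
    ∃ K : ℝ, 0 < K ∧ ∀ δ : ℝ, 0 < δ → δ < 1 →
      (∃ C : ℝ, 0 < C ∧
        ∀ n : ℕ, 3 ≤ n → ∀ (G : SimpleGraph (Fin n)) [DecidableRel G.Adj],
          Bandwidth.IsDense δ G →
        ∀ r : ℕ, r ≤ n → (r : ℝ) ≤ A * (1 / δ) * Real.log (Real.log n) →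
        ∀ ω : Bandwidth.Draws,
          -- the total running time
          (Bandwidth.time ω Bandwidth.algorithm2 (Bandwidth.input δ G r) : ℝ)
              ≤ C * ((n : ℝ) ^ 2 * Real.log (Real.log n)) ∧
          -- the breadth first searches from the roots
          (Bandwidth.time ω Bandwidth.bfsFromRoots (Bandwidth.stateBfs ω δ G r) : ℝ)
              ≤ C * ((n : ℝ) ^ 2 * Real.log (Real.log n)) ∧
          -- the creation of the table
          (Bandwidth.time ω Bandwidth.createTable (Bandwidth.stateTable ω δ G r) : ℝ)
              ≤ C * ((n : ℝ) * Real.log (Real.log n)) ∧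
          -- the number of placements of the roots, for each box size
          (∀ s : ℕ, δ * (n : ℝ) ≤ s → (s : ℝ) ≤ (n : ℝ) / 2 →
            ((⌈(n : ℝ) / (s : ℝ)⌉₊ : ℝ)) ^ r
              ≤ Real.log n ^ (K * ((1 / δ) * Real.log (1 / δ)))) ∧
          -- the search over all box sizes and all placements of the roots
          (Bandwidth.time ω Bandwidth.searchLayout (Bandwidth.stateSearch ω δ G r) : ℝ)
              ≤ C * ((n : ℝ) * Real.log (Real.log n)) *
                Real.log n ^ (K * ((1 / δ) * Real.log (1 / δ)))) ∧
      -- the search is negligible against the bound for the whole algorithm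
      (∀ ε : ℝ, 0 < ε → ∃ N : ℕ,
        ∀ n : ℕ, N ≤ n → ∀ (G : SimpleGraph (Fin n)) [DecidableRel G.Adj],
          Bandwidth.IsDense δ G →
        ∀ r : ℕ, r ≤ n → (r : ℝ) ≤ A * (1 / δ) * Real.log (Real.log n) →
        ∀ ω : Bandwidth.Draws,
          (Bandwidth.time ω Bandwidth.searchLayout (Bandwidth.stateSearch ω δ G r) : ℝ)
              ≤ ε * ((n : ℝ) ^ 2 * Real.log (Real.log n))) := by
  have hl3 := Bandwidth.loglog_three_pos
  -- The `2 * A` comes from `⌈1/δ⌉ ≤ (1/δ)²`, the `1` from the rounds of the binary search.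
  refine ⟨2 * A + 1, by linarith, fun δ h0 h1 => ?_⟩
  obtain ⟨C₄, hC₄, hS⟩ := Bandwidth.exists_time_searchLayout_le hA h0 h1
  have hlx : 0 ≤ Real.log (1 / δ) := Real.log_nonneg (by rw [le_div_iff₀ h0]; linarith)
  set E := (2 * A + 1) * ((1 / δ) * Real.log (1 / δ)) with hE
  have hE0 : 0 ≤ E := by positivity
  refine ⟨?_, ?_⟩
  · obtain ⟨D₁, hD₁⟩ := Bandwidth.exists_time_selectRoots_le
    obtain ⟨D₂, hD₂⟩ := Bandwidth.exists_time_bfsFromRoots_le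
    obtain ⟨D₃, hD₃⟩ := Bandwidth.exists_time_createTable_le
    set R := A * (1 / δ) + (Real.log (Real.log 3))⁻¹
    have hR : 0 < R := by positivity
    have hF : 0 < (E + 1) ^ (E + 1) := by positivity
    set F := (E + 1) ^ (E + 1)
    -- One constant for all claims: the summands with `R` pay for the first three steps, `C₄ * F`
    -- for the search within the total time, where `(log n) ^ E ≤ F n`, and `C₄` for the search
    -- measured by its own bound.
    refine ⟨D₁ * R + D₂ * R + D₃ * R + C₄ * F + C₄, by positivity, ?_⟩
    intro n hn G _ _ r hrn hr ω
    have hreg := Bandwidth.stateSearch_reg ω δ G r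
    have t₁ := hD₁ n r (by omega) ω
      (Bandwidth.input δ G r) rfl rfl
    have t₂ := hD₂ n r (by omega) ω
      (Bandwidth.stateBfs ω δ G r) (hreg.1 _ rfl) (hreg.1 _ rfl)
    have t₃ := hD₃ n r (by omega) ω
      (Bandwidth.stateTable ω δ G r) (hreg.2.1 _ rfl) (hreg.2.1 _ rfl)
    have t₄ := hS n hn G r hr ω
    rw [Bandwidth.time_algorithm2]
    clear hreg hS hD₁ hD₂ hD₃
    generalize Bandwidth.time ω Bandwidth.selectRoots (Bandwidth.input δ G r) = T₁ at *
    generalize Bandwidth.time ω Bandwidth.bfsFromRoots (Bandwidth.stateBfs ω δ G r) = T₂ at *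
    generalize Bandwidth.time ω Bandwidth.createTable (Bandwidth.stateTable ω δ G r) = T₃ at *
    generalize Bandwidth.time ω Bandwidth.searchLayout (Bandwidth.stateSearch ω δ G r) = T₄ at *
    have hr1 := Bandwidth.card_roots_le hn hr
    have hL := Bandwidth.one_lt_log hn
    have hM : 0 < Real.log (Real.log n) := Real.log_pos hL
    have hlog := Bandwidth.log_rpow_le hE0 hn
    have hn1 : (1 : ℝ) ≤ n := by
      have : 1 ≤ n := by omega
      exact_mod_cast this
    have hn2 : (n : ℝ) ≤ (n : ℝ) ^ 2 := le_self_pow₀ hn1 two_ne_zero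
    set M := Real.log (Real.log n)
    have u₁ : (T₁ : ℝ) ≤
        D₁ * R * (n * M) := by
      calc _ ≤ (D₁ : ℝ) * ((n : ℝ) ^ 1 * ((r : ℝ) + 1) ^ 1) := by exact_mod_cast t₁
        _ ≤ D₁ * ((n : ℝ) ^ 1 * (R * M) ^ 1) := by gcongr
        _ = _ := by ring
    have u₂ : (T₂ : ℝ) ≤
        D₂ * R * ((n : ℝ) ^ 2 * M) := by
      calc _ ≤ (D₂ : ℝ) * ((n : ℝ) ^ 2 * ((r : ℝ) + 1) ^ 1) := by exact_mod_cast t₂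
        _ ≤ D₂ * ((n : ℝ) ^ 2 * (R * M) ^ 1) := by gcongr
        _ = _ := by ring
    have u₃ : (T₃ : ℝ) ≤
        D₃ * R * (n * M) := by
      calc _ ≤ (D₃ : ℝ) * ((n : ℝ) ^ 1 * ((r : ℝ) + 1) ^ 1) := by exact_mod_cast t₃
        _ ≤ D₃ * ((n : ℝ) ^ 1 * (R * M) ^ 1) := by gcongr
        _ = _ := by ring
    have u₄ : (T₄ : ℝ) ≤
        C₄ * F * ((n : ℝ) ^ 2 * M) := by
      calc _ ≤ C₄ * (n * M) * Real.log n ^ E := t₄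
        _ ≤ C₄ * (n * M) * (F * n) := by gcongr
        _ = _ := by ring
    have hnM : (n : ℝ) * M ≤ (n : ℝ) ^ 2 * M := by gcongr
    have v₁ : D₁ * R * (n * M) ≤ D₁ * R * ((n : ℝ) ^ 2 * M) := by gcongr
    have v₃ : D₃ * R * (n * M) ≤ D₃ * R * ((n : ℝ) ^ 2 * M) := by gcongr
    have v₄ : 0 ≤ C₄ * ((n : ℝ) ^ 2 * M) := by positivity
    refine ⟨?_, ?_, ?_, ?_, ?_⟩
    · push_cast
      linarith only [u₁, u₂, u₃, u₄, v₁, v₃, v₄]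
    · refine u₂.trans (mul_le_mul_of_nonneg_right ?_ (by positivity))
      have : 0 ≤ D₁ * R + D₃ * R + C₄ * F + C₄ := by positivity
      linarith only [this]
    · refine u₃.trans (mul_le_mul_of_nonneg_right ?_ (by positivity))
      have : 0 ≤ D₁ * R + D₂ * R + C₄ * F + C₄ := by positivity
      linarith only [this]
    · intro s hs hs2
      exact Bandwidth.ceil_div_pow_le h0 hn hr hs hs2
    · refine t₄.trans (mul_le_mul_of_nonneg_right
        (mul_le_mul_of_nonneg_right ?_ (by positivity)) (by positivity))
      have : 0 ≤ D₁ * R + D₂ * R + D₃ * R + C₄ * F := by positivity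
      linarith only [this]
  · intro ε hε
    -- The tolerance `ε / C₄` cancels the constant of the search when one factor `n` replaces the
    -- power of `log n`.
    obtain ⟨N, hN⟩ := Bandwidth.exists_log_rpow_le E (div_pos hε hC₄)
    refine ⟨max N 3, fun n hn G _ _ r _ hr ω => ?_⟩
    have hn3 : 3 ≤ n := (le_max_right _ _).trans hn
    have hlog := hN n ((le_max_left _ _).trans hn)
    have hM : 0 < Real.log (Real.log n) := Real.log_pos (Bandwidth.one_lt_log hn3)
    calc _ ≤ C₄ * (n * Real.log (Real.log n)) * Real.log n ^ E := hS n hn3 G r hr ω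
      _ ≤ C₄ * (n * Real.log (Real.log n)) * (ε / C₄ * n) := by gcongr
      _ = _ := by field_simp
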